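/- Let $\Theta$ be a variety of (one-sorted, finitary) algebras, let $G\in\Theta$ with $|G|>1$, and let $\Theta^G$ be the variety of $G$-algebras: its objects are pairs $(H,h)$ with $H\in\Theta$ and $h:G\to H$ a homomorphism, and its morphisms $(H,h)\to(H',h')$ are the homomorphisms $\mu$ with $\mu h=h'$; $(H,h)$ is *faithful* if $h$ is injective. For a finite subset $X$ of a fixed infinite set of variables let $W(X)=G*W_0(X)$ be the free algebra of $\Theta^G$ over $X$, with the canonical map $i_G:G\to W(X)$, and let $(\Theta^G)^0$ be the category of all these $W(X)$, with all homomorphisms of $G$-algebras. Assume condition $(*)$: $G$ generates $\Theta^G$, i.e. for all $X$ and $w,w'\in W(X)$, if $\nu(w)=\nu(w')$ for every $G$-homomorphism $\nu:W(X)\to G$, then $w=w'$. *Definitions.* An automorphism $\varphi$ of $(\Theta^G)^0$ is *semi-inner* if there are an automorphism $\sigma$ of the algebra $G$ and, for each $W$, an isomorphism $s_W:W\to\varphi(W)$ of algebras in $\Theta$ with $s_W i_G=i_G\sigma$, such that $\varphi(\nu)=s_{W'}\nu s_W^{-1}$ for every $\nu:W\to W'$; it is *inner* if this holds with $\sigma=1$.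 An automorphism $\psi$ of the semigroup $\mathrm{End}\,W(x)$ (endomorphisms in $\Theta^G$, one variable $x$) is *semi-inner* if there are $\sigma\in\mathrm{Aut}(G)$ and an automorphism $s$ of $W(x)$ in $\Theta$ with $s\,i_G=i_G\sigma$ and $\psi(\nu)=s\nu s^{-1}$ for all $\nu$; it is *inner* if this holds with $\sigma=1$. The semigroup $\mathrm{End}\,W(x)$ (resp. the variety $\Theta^G$) is *perfect* if every automorphism of $\mathrm{End}\,W(x)$ (resp. of $(\Theta^G)^0$) is inner, and *semiperfect* if every such automorphism is semi-inner. $\Theta^G$ is *regular* if $W(X)\cong W(Y)$ in $\Theta^G$, with $X,Y$ finite, implies $|X|=|Y|$. For a $G$-algebra $H$ and a set $T$ of pairs of elements of $W(X)$ let $T'_H$ be the set of all $G$-homomorphisms $\nu:W(X)\to H$ with $\nu(w)=\nu(w')$ for all $(w,w')\in T$, and let $T''_H$ be the set of all pairs $(w,w')$ in $W(X)$ with $\nu(w)=\nu(w')$ for all $\nu\in T'_H$. $H_1$ and $H_2$ are *geometrically equivalent* if $T''_{H_1}=T''_{H_2}$ for all finite $X$ and all $T$. They are *semiisomorphic* if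 there are $\sigma\in\mathrm{Aut}(G)$ and an isomorphism $\mu:H_1\to H_2$ in $\Theta$ with $\mu h_1=h_2\sigma$. They are *geometrically equivalent up to a semiisomorphism* if there is a $G$-algebra $H$ semiisomorphic to $H_1$ and geometrically equivalent to $H_2$. The category $K_{\Theta^G}(H)$ has as objects the pairs $(X,A)$ with $A=T'_H$ for some system $T$ in $W(X)$, and as morphisms $(X,A)\to(Y,B)$ the maps $A\to B$ of the form $\nu\mapsto\nu s$ with a $G$-homomorphism $s:W(Y)\to W(X)$. An isomorphism of categories $F:K_{\Theta^G}(H_1)\to K_{\Theta^G}(H_2)$ is *correct* if it takes every affine space $(X,\mathrm{Hom}(W(X),H_1))$ to an affine space $(Y,\mathrm{Hom}(W(Y),H_2))$ with $|Y|=|X|$, and takes every identity embedding $(X,A)\to(X,\mathrm{Hom}(W(X),H_1))$ to an identity embedding. **Theorem.** 1. If $\mathrm{End}\,W(x)$ is perfect, then every automorphism $\varphi$ of $(\Theta^G)^0$ with $\varphi(W(x))\cong W(x)$ is inner; if moreover $\Theta^G$ is regular, then every automorphism of $(\Theta^G)^0$ is inner, i.e. $\Theta^G$ is perfect. 2. If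 $\mathrm{End}\,W(x)$ is semiperfect, then every automorphism $\varphi$ of $(\Theta^G)^0$ with $\varphi(W(x))\cong W(x)$ is semi-inner; if moreover $\Theta^G$ is regular, then every automorphism of $(\Theta^G)^0$ is semi-inner, i.e. $\Theta^G$ is semiperfect. 3. Let $H_1$ and $H_2$ be faithful $G$-algebras. If $\mathrm{End}\,W(x)$ is semiperfect, then $K_{\Theta^G}(H_1)$ and $K_{\Theta^G}(H_2)$ are correctly isomorphic if and only if $H_1$ and $H_2$ are geometrically equivalent up to a semiisomorphism. If $\mathrm{End}\,W(x)$ is perfect, then they are correctly isomorphic if and only if $H_1$ and $H_2$ are geometrically equivalent. -/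

import Mathlib

open CategoryTheory FirstOrder

namespace UniversalAG

open FirstOrder.Language (Term Structure)

universe uF uR uG uV w w₁ w₂ w₃

/-! ### Varieties of algebras

A signature is a first-order language `L` without relation symbols; a variety `Θ` is the class of
all `L`-algebras that satisfy a given set `E` of identities. -/

/-- An identity `t ≡ t'` in countably many variables. -/
abbrev Identity (L : FirstOrder.Language.{uF, uR}) : Type uF := L.Term ℕ × L.Term ℕ

/-- `M` belongs to the variety defined by the identities `E`. -/
def Satisfies {L : FirstOrder.Language.{uF, uR}} (E : Set (Identity L)) (M : Type w) [L.Structure M] : Prop :=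
  ∀ e ∈ E, ∀ v : ℕ → M, e.1.realize v = e.2.realize v

/-! ### The variety `Θ^G` of `G`-algebras -/

/-- A `G`-algebra `(H, h)`: an algebra `H` of the variety `Θ` with a homomorphism `h : G → H`. -/
structure GAlgebra {L : FirstOrder.Language.{uF, uR}} (E : Set (Identity L)) (G : Type uG) [L.Structure G] :
    Type (max uF uR uG (w + 1)) where
  carrier : Type w
  [str : L.Structure carrier]
  sat : Satisfies E carrier
  const : G →[L] carrier

attribute [instance] GAlgebra.str

section

variable {L : FirstOrder.Language.{uF, uR}} {E : Set (Identity L)} {G : Type uG} [L.Structure G]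

/-- `(H, h)` is faithful if `h` is injective. -/
def GAlgebra.Faithful (H : GAlgebra.{uF, uR, uG, w} E G) : Prop := Function.Injective H.const

/-- Homomorphisms of `G`-algebras `(A, a) → (B, b)`: homomorphisms `μ` with `μ ∘ a = b`. -/
structure GHom (A : GAlgebra.{uF, uR, uG, w₁} E G) (B : GAlgebra.{uF, uR, uG, w₂} E G) where
  toHom : A.carrier →[L] B.carrier
  map_const : ∀ g, toHom (A.const g) = B.const g

namespace GHom

instance (A : GAlgebra.{uF, uR, uG, w₁} E G) (B : GAlgebra.{uF, uR, uG, w₂} E G) :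
    CoeFun (GHom A B) (fun _ => A.carrier → B.carrier) :=
  ⟨fun μ => μ.toHom⟩

@[ext]
theorem ext {A : GAlgebra.{uF, uR, uG, w₁} E G} {B : GAlgebra.{uF, uR, uG, w₂} E G}
    {μ ν : GHom A B} (h : ∀ a, μ a = ν a) : μ = ν := by
  obtain ⟨μ, _⟩ := μ
  obtain ⟨ν, _⟩ := ν
  obtain rfl : μ = ν := FirstOrder.Language.Hom.ext h
  rfl

/-- The identity homomorphism. -/
def id (A : GAlgebra.{uF, uR, uG, w₁} E G) : GHom A A := ⟨FirstOrder.Language.Hom.id L _, fun _ => rfl⟩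

/-- The composite `μ ∘ ν`. -/
def comp {A : GAlgebra.{uF, uR, uG, w₁} E G} {B : GAlgebra.{uF, uR, uG, w₂} E G}
    {C : GAlgebra.{uF, uR, uG, w₃} E G} (μ : GHom B C) (ν : GHom A B) : GHom A C where
  toHom := μ.toHom.comp ν.toHom
  map_const g := by
    rw [FirstOrder.Language.Hom.comp_apply, ν.map_const, μ.map_const]

end GHom

/-- `G` itself, as a `G`-algebra through the identity map. -/
def baseAlgebra (hG : Satisfies E G) : GAlgebra.{uF, uR, uG, uG} E G where
  carrier := G
  sat := hG
  const := FirstOrder.Language.Hom.id L G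

/-- `(H₁, h₁)` and `(H₂, h₂)` are semiisomorphic: there are an automorphism `σ` of the algebra `G`
and an isomorphism `μ : H₁ → H₂` of algebras in `Θ` with `μ ∘ h₁ = h₂ ∘ σ`. -/
def SemiIsomorphic (H₁ : GAlgebra.{uF, uR, uG, w₁} E G) (H₂ : GAlgebra.{uF, uR, uG, w₂} E G) :
    Prop :=
  ∃ (σ : G ≃[L] G) (μ : H₁.carrier ≃[L] H₂.carrier), ∀ g, μ (H₁.const g) = H₂.const (σ g)

/-! ### The free `G`-algebras `W(X) = G * W₀(X)` -/

/-- The congruence on the algebra of terms over `G ⊔ X` generated by the identities of `Θ` and by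
the defining relations of the algebra `G`. -/
inductive FreeRel (E : Set (Identity L)) (G : Type uG) [L.Structure G] (X : Type uV) :
    L.Term (G ⊕ X) → L.Term (G ⊕ X) → Prop
  | refl (t) : FreeRel E G X t t
  | symm {t t'} : FreeRel E G X t t' → FreeRel E G X t' t
  | trans {t t' t''} : FreeRel E G X t t' → FreeRel E G X t' t'' → FreeRel E G X t t''
  | func {n : ℕ} (f : L.Functions n) {ts ts' : Fin n → L.Term (G ⊕ X)} :
      (∀ i, FreeRel E G X (ts i) (ts' i)) → FreeRel E G X (Term.func f ts) (Term.func f ts')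
  | ident (e : Identity L) (he : e ∈ E) (v : ℕ → L.Term (G ⊕ X)) :
      FreeRel E G X (e.1.subst v) (e.2.subst v)
  | const {n : ℕ} (f : L.Functions n) (a : Fin n → G) :
      FreeRel E G X (Term.func f fun i => Term.var (Sum.inl (a i)))
        (Term.var (Sum.inl (Structure.funMap f a)))

/-- The congruence `FreeRel` as a setoid. -/
def freeSetoid (E : Set (Identity L)) (G : Type uG) [L.Structure G] (X : Type uV) :
    Setoid (L.Term (G ⊕ X)) :=
  ⟨FreeRel E G X, ⟨.refl, .symm, .trans⟩⟩

/-- The underlying set of `W(X)`. -/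
def FreeCarrier (E : Set (Identity L)) (G : Type uG) [L.Structure G] (X : Type uV) :
    Type (max uF uG uV) :=
  Quotient (freeSetoid E G X)

namespace FreeCarrier

variable {X : Type uV}

/-- The class of a term. -/
def mk (t : L.Term (G ⊕ X)) : FreeCarrier E G X := Quotient.mk (freeSetoid E G X) t

theorem mk_eq_mk {t t' : L.Term (G ⊕ X)} :
    (mk t : FreeCarrier E G X) = mk t' ↔ FreeRel E G X t t' :=
  Quotient.eq (r := freeSetoid E G X)

noncomputable instance [L.IsAlgebraic] : L.Structure (FreeCarrier E G X) where
  funMap f a := mk (Term.func f fun i => Quotient.out (a i))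
  RelMap r := isEmptyElim r

variable [L.IsAlgebraic]

theorem funMap_mk {n : ℕ} (f : L.Functions n) (ts : Fin n → L.Term (G ⊕ X)) :
    Structure.funMap f (fun i => (mk (ts i) : FreeCarrier E G X)) = mk (Term.func f ts) :=
  mk_eq_mk.2 (.func f fun i => Quotient.mk_out (s := freeSetoid E G X) (ts i))

theorem realize_mk {α : Type*} (t : L.Term α) (v : α → L.Term (G ⊕ X)) :
    t.realize (fun a => (mk (v a) : FreeCarrier E G X)) = mk (t.subst v) := by
  induction t with
  | var a => rfl
  | func f ts ih =>
    rw [Term.realize_func, Term.subst, ← funMap_mk]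
    exact congrArg _ (funext ih)

theorem satisfies : Satisfies E (FreeCarrier E G X) := by
  intro e he v
  have hv : v = fun n => mk (Quotient.out (v n)) := funext fun n => (Quotient.out_eq _).symm
  rw [hv, realize_mk, realize_mk]
  exact mk_eq_mk.2 (.ident e he _)

end FreeCarrier

variable [L.IsAlgebraic]

/-- The free `G`-algebra `W(X)`, with the canonical map `i_G : G → W(X)`. -/
noncomputable def free (E : Set (Identity L)) (G : Type uG) [L.Structure G] (X : Type uV) :
    GAlgebra.{uF, uR, uG, max uF uG uV} E G where
  carrier := FreeCarrier E G X
  sat := FreeCarrier.satisfies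
  const :=
    { toFun := fun g => FreeCarrier.mk (Term.var (Sum.inl g))
      map_fun' := fun f a =>
        ((FreeCarrier.funMap_mk f _).trans (FreeCarrier.mk_eq_mk.2 (.const f a))).symm
      map_rel' := fun r => isEmptyElim r }

/-- The free generators of `W(X)`. -/
def free.gen {X : Type uV} (x : X) : (free E G X).carrier := FreeCarrier.mk (Term.var (Sum.inr x))

/-- `W(X)` is free over `X` in `Θ^G`; that is, it is the free product in `Θ` of `G` and of the free
algebra over `X`. -/
theorem free.existsUnique_lift {X : Type uV} (H : GAlgebra.{uF, uR, uG, w} E G)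
    (p : X → H.carrier) : ∃! μ : GHom (free E G X) H, ∀ x, μ (free.gen x) = p x := by
  have hrel : ∀ {t t' : L.Term (G ⊕ X)}, FreeRel E G X t t' →
      t.realize (Sum.elim H.const p) = t'.realize (Sum.elim H.const p) := by
    intro t t' h
    induction h with
    | refl => rfl
    | symm _ ih => exact ih.symm
    | trans _ _ ih ih' => exact ih.trans ih'
    | func f _ ih => exact congrArg (Structure.funMap f) (funext ih)
    | ident e he v => rw [Term.realize_subst, Term.realize_subst]; exact H.sat e he _
    | const f a => exact (H.const.map_fun f a).symm
  let F : FreeCarrier E G X → H.carrier :=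
    Quotient.lift (s := freeSetoid E G X) (fun t => t.realize (Sum.elim H.const p))
      fun _ _ h => hrel h
  refine ⟨⟨⟨F, fun f a => ?_, fun r => isEmptyElim r⟩, fun _ => rfl⟩, fun _ => rfl, ?_⟩
  · choose ts hts using fun i => Quotient.exists_rep (a i)
    obtain rfl : (fun i => FreeCarrier.mk (ts i)) = a := funext hts
    exact congrArg F (FreeCarrier.funMap_mk f ts)
  · intro μ hμ
    ext a
    obtain ⟨t, rfl⟩ : ∃ t, FreeCarrier.mk t = a := Quotient.exists_rep a
    change μ (FreeCarrier.mk t) = t.realize (Sum.elim H.const p)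
    induction t with
    | var a =>
      rcases a with g | x
      · exact μ.map_const g
      · exact hμ x
    | func f ts ih =>
      rw [← FreeCarrier.funMap_mk, Term.realize_func]
      exact (μ.toHom.map_fun f _).trans (congrArg _ (funext ih))

/-! ### The category `(Θ^G)⁰` of finitely generated free algebras -/

/-- The free algebra `W(X)` over a finite set `X` of variables from the alphabet `V`. -/
noncomputable abbrev W (E : Set (Identity L)) (G : Type uG) [L.Structure G] {V : Type uV}
    (X : Finset V) : GAlgebra.{uF, uR, uG, max uF uG uV} E G :=
  free E G {v // v ∈ X}

/-- Objects of the category `(Θ^G)⁰`: the algebras `W(X)` for the finite subsets `X` of `V`. -/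
structure FreeCat (E : Set (Identity L)) (G : Type uG) [L.Structure G] (V : Type uV) where
  vars : Finset V

/-- Morphisms in `(Θ^G)⁰` are all homomorphisms of `G`-algebras. -/
noncomputable instance (V : Type uV) : Category (FreeCat E G V) where
  Hom X Y := GHom (W E G X.vars) (W E G Y.vars)
  id X := GHom.id _
  comp f g := g.comp f

/-- A morphism of `(Θ^G)⁰`, as a map. -/
noncomputable abbrev FreeCat.app {V : Type uV} {X Y : FreeCat E G V} (ν : X ⟶ Y) :
    (W E G X.vars).carrier → (W E G Y.vars).carrier :=
  (show GHom (W E G X.vars) (W E G Y.vars) from ν).toHom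

/-- Condition `(∗)`: `G` generates `Θ^G`, i.e. the algebra `G` has no non-trivial identities with
coefficients from `G`. -/
def ConditionStar (hG : Satisfies E G) (V : Type uV) : Prop :=
  ∀ (X : Finset V) (t t' : (W E G X).carrier),
    (∀ ν : GHom (W E G X) (baseAlgebra hG), ν t = ν t') → t = t'

/-- `Θ^G` is regular: isomorphic free algebras over finite sets have equally many generators. -/
def RegularVariety (E : Set (Identity L)) (G : Type uG) [L.Structure G] (V : Type uV) : Prop :=
  ∀ X Y : FreeCat E G V, Nonempty (X ≅ Y) → X.vars.card = Y.vars.card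

end

/-- An automorphism `φ` of a category `C` is inner: there are isomorphisms `s_A : A → φ(A)` with
`φ(ν) = s_B ν s_A⁻¹` for every `ν : A → B`. -/
def IsInner {C : Type*} [Category C] (φ : IsoCat C C) : Prop :=
  ∃ s : ∀ A : C, A ≅ φ.functor.obj A,
    ∀ {A B : C} (ν : A ⟶ B), φ.functor.map ν = (s A).inv ≫ ν ≫ (s B).hom

section

variable {L : FirstOrder.Language.{uF, uR}} [L.IsAlgebraic] (E : Set (Identity L)) (G : Type uG)
  [L.Structure G] (V : Type uV)

variable {E G V} in
/-- An automorphism `φ` of `(Θ^G)⁰` is semi-inner: there are an automorphism `σ` of the algebra `G`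
and isomorphisms `s_W : W → φ(W)` of algebras in `Θ` with `s_W ∘ i_G = i_G ∘ σ`, such that
`φ(ν) = s_{W'} ν s_W⁻¹` for every `ν : W → W'`. -/
def IsSemiInner (φ : IsoCat (FreeCat E G V) (FreeCat E G V)) : Prop :=
  ∃ (σ : G ≃[L] G)
    (s : ∀ X : FreeCat E G V,
      (W E G X.vars).carrier ≃[L] (W E G (φ.functor.obj X).vars).carrier),
    (∀ X g, s X ((W E G X.vars).const g) = (W E G (φ.functor.obj X).vars).const (σ g)) ∧
      ∀ {X Y : FreeCat E G V} (ν : X ⟶ Y) (a : (W E G X.vars).carrier),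
        FreeCat.app (φ.functor.map ν) (s X a) = s Y (FreeCat.app ν a)

/-- The variety `Θ^G` is perfect. -/
def VarietyPerfect : Prop := ∀ φ : IsoCat (FreeCat E G V) (FreeCat E G V), IsInner φ

/-- The variety `Θ^G` is semiperfect. -/
def VarietySemiperfect : Prop := ∀ φ : IsoCat (FreeCat E G V) (FreeCat E G V), IsSemiInner φ

variable {V}

/-- The algebra `W(x)` as an object of `(Θ^G)⁰`. -/
def oneGen (x : V) : FreeCat E G V := ⟨{x}⟩

variable {E G} in
/-- An automorphism `ψ` of the semigroup `End W(x)` is given by the semiautomorphism `(σ, s)` of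
`W(x)`: `s ∘ i_G = i_G ∘ σ` and `ψ(ν) = s ν s⁻¹` for all `ν`. -/
def GivenBy {x : V} (ψ : End (oneGen E G x) ≃* End (oneGen E G x)) (σ : G ≃[L] G)
    (s : (W E G (oneGen E G x).vars).carrier ≃[L] (W E G (oneGen E G x).vars).carrier) : Prop :=
  (∀ g, s ((W E G (oneGen E G x).vars).const g) = (W E G (oneGen E G x).vars).const (σ g)) ∧
    ∀ (ν : End (oneGen E G x)) (a : (W E G (oneGen E G x).vars).carrier),
      FreeCat.app (ψ ν).asHom (s a) = s (FreeCat.app ν.asHom a)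

/-- The semigroup `End W(x)` is perfect: each of its automorphisms is inner. -/
def EndPerfect (x : V) : Prop :=
  ∀ ψ : End (oneGen E G x) ≃* End (oneGen E G x), ∃ s, GivenBy ψ (FirstOrder.Language.Equiv.refl L G) s

/-- The semigroup `End W(x)` is semiperfect: each of its automorphisms is semi-inner. -/
def EndSemiperfect (x : V) : Prop :=
  ∀ ψ : End (oneGen E G x) ≃* End (oneGen E G x), ∃ σ s, GivenBy ψ σ s

end

/-! ### Algebraic sets, their category, and geometric equivalence -/

section

variable {L : FirstOrder.Language.{uF, uR}} [L.IsAlgebraic] {E : Set (Identity L)} {G : Type uG}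
  [L.Structure G] {V : Type uV}

/-- `T'_H`: the points `ν : W(X) → H` that satisfy all equations of the system `T`. -/
def zeros (H : GAlgebra.{uF, uR, uG, w} E G) {X : Finset V}
    (T : Set ((W E G X).carrier × (W E G X).carrier)) : Set (GHom (W E G X) H) :=
  {ν | ∀ t ∈ T, ν t.1 = ν t.2}

/-- `A'`: the equations that hold at all points of `A`. -/
def equations {H : GAlgebra.{uF, uR, uG, w} E G} {X : Finset V} (A : Set (GHom (W E G X) H)) :
    Set ((W E G X).carrier × (W E G X).carrier) :=
  {t | ∀ ν ∈ A, ν t.1 = ν t.2}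

variable (V) in
/-- `H₁` and `H₂` are geometrically equivalent: `T''_{H₁} = T''_{H₂}` for every finite `X` and every
system of equations `T` in `W(X)`. -/
def GeometricallyEquivalent (H₁ : GAlgebra.{uF, uR, uG, w₁} E G)
    (H₂ : GAlgebra.{uF, uR, uG, w₂} E G) : Prop :=
  ∀ (X : Finset V) (T : Set ((W E G X).carrier × (W E G X).carrier)),
    equations (zeros H₁ T) = equations (zeros H₂ T)

variable (V) in
/-- `H₁` and `H₂` are geometrically equivalent up to a semiisomorphism. -/
def GeometricallyEquivalentUpToSemi (H₁ H₂ : GAlgebra.{uF, uR, uG, w} E G) : Prop :=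
  ∃ H : GAlgebra.{uF, uR, uG, w} E G, SemiIsomorphic H₁ H ∧ GeometricallyEquivalent V H H₂

variable (V) in
/-- Objects `(X, A)` of the category `K_{Θ^G}(H)`: `A` is an algebraic set in `Hom(W(X), H)`. -/
structure AlgSet (H : GAlgebra.{uF, uR, uG, w} E G) where
  vars : Finset V
  pts : Set (GHom (W E G vars) H)
  algebraic : ∃ T : Set ((W E G vars).carrier × (W E G vars).carrier), pts = zeros H T

namespace AlgSet

variable {H : GAlgebra.{uF, uR, uG, w} E G}

/-- Morphisms `(X, A) → (Y, B)` in `K_{Θ^G}(H)`: the maps `[s] : A → B`, `[s](ν) = ν s`, for the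
homomorphisms `s : W(Y) → W(X)` that are admissible with respect to `A` and `B`. -/
@[ext]
structure Hom (P Q : AlgSet V H) where
  map : P.pts → Q.pts
  induced : ∃ s : GHom (W E G Q.vars) (W E G P.vars),
    ∀ ν : P.pts, (map ν : GHom (W E G Q.vars) H) = (ν : GHom (W E G P.vars) H).comp s

/-- The category `K_{Θ^G}(H)` of algebraic sets over `H`. -/
instance : Category (AlgSet V H) where
  Hom P Q := Hom P Q
  id P := ⟨_root_.id, GHom.id _, fun _ => rfl⟩
  comp f g := ⟨g.map ∘ f.map, by
    obtain ⟨s, hs⟩ := f.induced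
    obtain ⟨r, hr⟩ := g.induced
    refine ⟨s.comp r, fun ν => ?_⟩
    rw [Function.comp_apply, hr, hs]
    rfl⟩

/-- The affine space `Hom(W(X), H)` as an algebraic set. -/
def affine (H : GAlgebra.{uF, uR, uG, w} E G) (X : Finset V) : AlgSet V H :=
  ⟨X, Set.univ, ∅, by simp [zeros]⟩

/-- The identity embedding `A → Hom(W(X), H)` as a morphism of `K_{Θ^G}(H)`. -/
def incl (P : AlgSet V H) : P ⟶ affine H P.vars :=
  Hom.mk (fun ν => ⟨ν.1, trivial⟩) ⟨GHom.id _, fun _ => rfl⟩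

/-- A morphism of `K_{Θ^G}(H)` is an identity embedding `(X, A) → (X, Hom(W(X), H))`. -/
inductive IsIdentityEmbedding : ∀ {P Q : AlgSet V H}, (P ⟶ Q) → Prop
  | incl (P : AlgSet V H) : IsIdentityEmbedding P.incl

end AlgSet

/-- An isomorphism of categories `F : K_{Θ^G}(H₁) → K_{Θ^G}(H₂)` is correct: it takes each affine
space `Hom(W(X), H₁)` to an affine space `Hom(W(Y), H₂)` with `|Y| = |X|`, and it takes identity
embeddings `A → Hom(W(X), H₁)` to identity embeddings. -/
def IsCorrect {H₁ : GAlgebra.{uF, uR, uG, w₁} E G} {H₂ : GAlgebra.{uF, uR, uG, w₂} E G}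
    (F : IsoCat (AlgSet V H₁) (AlgSet V H₂)) : Prop :=
  (∀ X : Finset V, ∃ Y : Finset V, Y.card = X.card ∧
      F.functor.obj (AlgSet.affine H₁ X) = AlgSet.affine H₂ Y) ∧
    ∀ P : AlgSet V H₁, AlgSet.IsIdentityEmbedding (F.functor.map P.incl)

variable (V) in
/-- The categories `K_{Θ^G}(H₁)` and `K_{Θ^G}(H₂)` are correctly isomorphic. -/
def CorrectlyIsomorphic (H₁ : GAlgebra.{uF, uR, uG, w₁} E G)
    (H₂ : GAlgebra.{uF, uR, uG, w₂} E G) : Prop :=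
  ∃ F : IsoCat (AlgSet V H₁) (AlgSet V H₂), IsCorrect F

end

end UniversalAG

open UniversalAG

/-!
An element `w` of `W(X)` is the same thing as a morphism `W(x) → W(X)`, the one that takes `x` to
`w`. If an automorphism `φ` of `(Θ^G)⁰` takes `W(x)` to an isomorphic copy, it therefore induces a
natural family of bijections `W(X) → φ(W(X))`, normalized by the choice of a generator of
`φ(W(x))`. When `φ` acts on `End W(x)` through a semiautomorphism of `W(x)`, the generator can be
chosen so that the bijection at `W(x)` is a semi-isomorphism. Condition `(∗)` says that morphisms to
`W(x)` separate the elements of every `W(X)`, so by naturality all the bijections are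
semi-isomorphisms, over the same automorphism of `G`; this is `exists_semiInnerBy`. If `Θ^G` is
regular, then every `φ` preserves `W(x)`, because `φ` preserves coproducts and so multiplies the
numbers of generators by that of `φ(W(x))` (`RegularVariety.nonempty_iso`).

Over a faithful algebra `H`, condition `(∗)` makes the affine spaces a full subcategory of `K(H)`
that is dual to `(Θ^G)⁰`. A correct isomorphism `K(H₁) → K(H₂)` restricts to these subcategories and
yields an automorphism of `(Θ^G)⁰` that preserves numbers of generators, hence a semi-inner one.
Equations of an algebraic set are equalities between composites of its identity embedding with
morphisms to the affine line, so the isomorphism transports them by the semi-isomorphisms `s_W`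
(`IsCorrect.exists_equations_iff`). Consequently the closure operators `T ↦ T''` of `H₁` and `H₂`
correspond under `s_W`, which says that `H₁` with its structure map twisted by `σ⁻¹` is
geometrically equivalent to `H₂` (`IsCorrect.geometricallyEquivalent_twist`); for `σ = 1` the twist
does nothing.

Conversely, morphisms of `K(H)` are homomorphisms of free algebras modulo closed systems of
equations, and admissibility too depends only on these. A family of semiautomorphisms of the
algebras `W(X)` that matches the closed systems for `H₁` and `H₂` thus gives an isomorphism
`[r] ↦ [s r s⁻¹]` of the two categories (`AlgSet.correctlyIsomorphic_of_matchesClosure`).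
-/

namespace UniversalAG

open FirstOrder.Language (Term Structure)

universe uA uA' uB uB' uC uC' uH

/-! ### Semi-isomorphisms and conjugation -/

section Semi

variable {L : FirstOrder.Language.{uF, uR}} {E : Set (Identity L)} {G : Type uG} [L.Structure G]
  {A : GAlgebra.{uF, uR, uG, uA} E G} {A' : GAlgebra.{uF, uR, uG, uA'} E G}
  {B : GAlgebra.{uF, uR, uG, uB} E G} {B' : GAlgebra.{uF, uR, uG, uB'} E G} {σ : G ≃[L] G}

/-- An isomorphism `s : A → A'` of algebras in `Θ` lies over the automorphism `σ` of `G` if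
`s ∘ a = a' ∘ σ`, where `a` and `a'` are the structure maps of `A` and `A'`. -/
def IsOver (σ : G ≃[L] G) (s : A.carrier ≃[L] A'.carrier) : Prop :=
  ∀ g, s (A.const g) = A'.const (σ g)

theorem IsOver.symm {s : A.carrier ≃[L] A'.carrier} (hs : IsOver σ s) : IsOver σ.symm s.symm := by
  intro g
  apply s.injective
  rw [hs, s.apply_symm_apply, σ.apply_symm_apply]

theorem isOver_refl (A : GAlgebra.{uF, uR, uG, uA} E G) :
    IsOver (A := A) (A' := A) (FirstOrder.Language.Equiv.refl L G)
      (FirstOrder.Language.Equiv.refl L A.carrier) := fun _ => rfl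

/-- The conjugate `t ∘ ν ∘ s⁻¹`, for `s` and `t` over the same automorphism of `G`. -/
def GHom.conj {s : A.carrier ≃[L] A'.carrier} {t : B.carrier ≃[L] B'.carrier}
    (hs : IsOver σ s) (ht : IsOver σ t) (ν : GHom A B) : GHom A' B' where
  toHom := t.toHom.comp (ν.toHom.comp s.symm.toHom)
  map_const g := by
    change t (ν (s.symm (A'.const g))) = _
    rw [hs.symm, ν.map_const, ht, σ.apply_symm_apply]

theorem GHom.conj_apply {s : A.carrier ≃[L] A'.carrier} {t : B.carrier ≃[L] B'.carrier}
    (hs : IsOver σ s) (ht : IsOver σ t) (ν : GHom A B) (a : A.carrier) :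
    ν.conj hs ht (s a) = t (ν a) :=
  congrArg (fun a => t (ν a)) (s.symm_apply_apply a)

/-- Conjugation by `s` and `t` reaches every homomorphism `A' → B'`. -/
theorem GHom.exists_conj_eq {s : A.carrier ≃[L] A'.carrier} {t : B.carrier ≃[L] B'.carrier}
    (hs : IsOver σ s) (ht : IsOver σ t) (ν' : GHom A' B') :
    ∃ ν : GHom A B, ν.conj hs ht = ν' := by
  refine ⟨ν'.conj hs.symm ht.symm, GHom.ext fun a => ?_⟩
  obtain ⟨a, rfl⟩ := s.surjective a
  rw [GHom.conj_apply]
  change t (t.symm (ν' (s a))) = _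
  rw [t.apply_symm_apply]

theorem GHom.conj_id {s : A.carrier ≃[L] A'.carrier} (hs : IsOver σ s) :
    (GHom.id A).conj hs hs = GHom.id A' := by
  ext a
  obtain ⟨a, rfl⟩ := s.surjective a
  exact GHom.conj_apply hs hs _ a

theorem GHom.conj_comp {C : GAlgebra.{uF, uR, uG, uC} E G} {C' : GAlgebra.{uF, uR, uG, uC'} E G}
    {s : A.carrier ≃[L] A'.carrier} {t : B.carrier ≃[L] B'.carrier}
    {u : C.carrier ≃[L] C'.carrier} (hs : IsOver σ s) (ht : IsOver σ t) (hu : IsOver σ u)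
    (μ : GHom A B) (ν : GHom B C) :
    (ν.comp μ).conj hs hu = (ν.conj ht hu).comp (μ.conj hs ht) := by
  ext a
  obtain ⟨a, rfl⟩ := s.surjective a
  rw [GHom.conj_apply]
  change u (ν (μ a)) = ν.conj ht hu (μ.conj hs ht (s a))
  rw [GHom.conj_apply, GHom.conj_apply]

/-- The algebra `A` with its structure map precomposed with the automorphism `σ` of `G`. -/
def GAlgebra.twist (A : GAlgebra.{uF, uR, uG, uA} E G) (σ : G ≃[L] G) :
    GAlgebra.{uF, uR, uG, uA} E G where
  carrier := A.carrier
  sat := A.sat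
  const := A.const.comp σ.toHom

/-- The identity map of `A`, as an isomorphism of algebras in `Θ` from the twisted `G`-algebra. -/
def GAlgebra.untwist (A : GAlgebra.{uF, uR, uG, uA} E G) (σ : G ≃[L] G) :
    (A.twist σ).carrier ≃[L] A.carrier := FirstOrder.Language.Equiv.refl L A.carrier

theorem GAlgebra.isOver_untwist (A : GAlgebra.{uF, uR, uG, uA} E G) (σ : G ≃[L] G) :
    IsOver σ (A.untwist σ) := fun _ => rfl

theorem GAlgebra.isOver_untwist_symm (A : GAlgebra.{uF, uR, uG, uA} E G) (σ : G ≃[L] G) :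
    IsOver σ (A.untwist σ.symm).symm :=
  fun g => (congrArg A.const (σ.symm_apply_apply g)).symm

/-- The structure map of a `G`-algebra, as a homomorphism of `G`-algebras. -/
def GHom.ofBase (hG : Satisfies E G) (A : GAlgebra.{uF, uR, uG, uA} E G) :
    GHom (baseAlgebra hG) A := ⟨A.const, fun _ => rfl⟩

end Semi

/-! ### Homomorphisms from free algebras -/

section Free

variable {L : FirstOrder.Language.{uF, uR}} [L.IsAlgebraic] {E : Set (Identity L)} {G : Type uG}
  [L.Structure G] {X : Type uV} {H : GAlgebra.{uF, uR, uG, uH} E G}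
  {B : GAlgebra.{uF, uR, uG, uB} E G} {σ : G ≃[L] G}

theorem free.hom_ext {μ ν : GHom (free E G X) H} (h : ∀ x, μ (free.gen x) = ν (free.gen x)) :
    μ = ν :=
  (free.existsUnique_lift H fun x => ν (free.gen x)).unique h fun _ => rfl

/-- The homomorphism `W(X) → H` with given values at the free generators. -/
noncomputable def free.lift (H : GAlgebra.{uF, uR, uG, uH} E G) (p : X → H.carrier) :
    GHom (free E G X) H := (free.existsUnique_lift H p).choose

@[simp]
theorem free.lift_gen (p : X → H.carrier) (x : X) : free.lift H p (free.gen x) = p x :=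
  (free.existsUnique_lift H p).choose_spec.1 x

/-- The image of a free basis under a semi-isomorphism is a free basis. -/
theorem free.existsUnique_lift_of_isOver {s : (free E G X).carrier ≃[L] B.carrier}
    (hs : IsOver σ s) (p : X → H.carrier) : ∃! μ : GHom B H, ∀ x, μ (s (free.gen x)) = p x := by
  have ht := H.isOver_untwist σ
  let q : X → (H.twist σ).carrier := p
  refine ⟨(free.lift (H.twist σ) q).conj hs ht, fun x => ?_, fun μ hμ => ?_⟩
  · rw [GHom.conj_apply]
    exact free.lift_gen q x
  · obtain ⟨ν, rfl⟩ := GHom.exists_conj_eq hs ht μ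
    congr 1
    refine free.hom_ext fun x => ?_
    rw [free.lift_gen]
    exact (GHom.conj_apply hs ht ν _).symm.trans (hμ x)

/-- Every automorphism of `G` extends to an automorphism of the algebra `W(X)`: the one that fixes
the free generators. -/
theorem free.exists_isOver (E : Set (Identity L)) (σ : G ≃[L] G) (X : Type uV) :
    ∃ s : (free E G X).carrier ≃[L] (free E G X).carrier, IsOver σ s := by
  let f (τ : G ≃[L] G) : GHom (free E G X) ((free E G X).twist τ) :=
    free.lift ((free E G X).twist τ) free.gen
  have hconst (τ : G ≃[L] G) (g : G) : f τ ((free E G X).const g) = (free E G X).const (τ g) :=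
    (f τ).map_const g
  have hinv (τ ρ : G ≃[L] G) (h : ∀ g, ρ (τ g) = g) (a : (free E G X).carrier) :
      f ρ (f τ a) = a := by
    let c : GHom (free E G X) (free E G X) :=
      ⟨FirstOrder.Language.Hom.comp (f ρ).toHom (f τ).toHom, fun g => by
        change f ρ (f τ _) = _
        rw [hconst, hconst, h]⟩
    have hc : c = GHom.id _ := by
      refine free.hom_ext fun x => ?_
      change f ρ (f τ (free.gen x)) = free.gen x
      have hgen (κ : G ≃[L] G) : f κ (free.gen x) = free.gen x :=
        free.lift_gen (H := (free E G X).twist κ) free.gen x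
      rw [hgen, hgen]
    exact congrArg (fun c : GHom (free E G X) (free E G X) => c a) hc
  refine ⟨⟨⟨f σ, f σ.symm, hinv _ _ σ.symm_apply_apply, hinv _ _ σ.apply_symm_apply⟩,
    fun F a => (f σ).toHom.map_fun F a, fun r => isEmptyElim r⟩, hconst σ⟩

/-- `G` is a retract of `W(X)`. -/
theorem free.faithful [Nonempty G] (hG : Satisfies E G) : (free E G X).Faithful := by
  intro g g' h
  let ρ := free.lift (X := X) (baseAlgebra hG) fun _ => (Classical.arbitrary G : G)
  have := congrArg ρ h
  rwa [ρ.map_const, ρ.map_const] at this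

end Free

section Separation

variable {L : FirstOrder.Language.{uF, uR}} [L.IsAlgebraic] {E : Set (Identity L)} {G : Type uG}
  [L.Structure G] {V : Type uV}

/-- Under condition `(∗)` the homomorphisms from `W(X)` to a faithful `G`-algebra separate the
elements of `W(X)`, because such an algebra contains `G`. -/
theorem ConditionStar.eq_of_forall_hom {hG : Satisfies E G} (hstar : ConditionStar hG V)
    {H : GAlgebra.{uF, uR, uG, uH} E G} (hH : H.Faithful) {X : Finset V}
    {a b : (W E G X).carrier} (h : ∀ μ : GHom (W E G X) H, μ a = μ b) : a = b :=
  hstar X a b fun ν => hH (h ((GHom.ofBase hG H).comp ν))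

end Separation

/-! ### Automorphisms of the category of free algebras -/

section Automorphisms

variable {L : FirstOrder.Language.{uF, uR}} [L.IsAlgebraic] {E : Set (Identity L)} {G : Type uG}
  [L.Structure G] {V : Type uV}

namespace FreeCat

theorem app_comp {X Y Z : FreeCat E G V} (f : X ⟶ Y) (g : Y ⟶ Z) (a : (W E G X.vars).carrier) :
    app (f ≫ g) a = app g (app f a) := rfl

theorem app_id (X : FreeCat E G V) (a : (W E G X.vars).carrier) : app (𝟙 X) a = a := rfl

theorem app_const {X Y : FreeCat E G V} (f : X ⟶ Y) (g : G) :
    app f ((W E G X.vars).const g) = (W E G Y.vars).const g := GHom.map_const _ g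

theorem app_funMap {X Y : FreeCat E G V} (f : X ⟶ Y) {n : ℕ} (F : L.Functions n)
    (a : Fin n → (W E G X.vars).carrier) :
    app f (Structure.funMap F a) = Structure.funMap F fun i => app f (a i) :=
  FirstOrder.Language.Hom.map_fun _ F a

theorem hom_ext {X Y : FreeCat E G V} {f g : X ⟶ Y}
    (h : ∀ a : (W E G X.vars).carrier, app f a = app g a) : f = g := GHom.ext h

theorem hom_ext_gen {X Y : FreeCat E G V} {f g : X ⟶ Y}
    (h : ∀ v : {v // v ∈ X.vars}, app f (free.gen v) = app g (free.gen v)) : f = g :=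
  free.hom_ext h

/-- The morphism of `(Θ^G)⁰` with given values at the free generators. -/
noncomputable def ofGen {X Y : FreeCat E G V} (p : {v // v ∈ X.vars} → (W E G Y.vars).carrier) :
    X ⟶ Y := free.lift (W E G Y.vars) p

@[simp]
theorem app_ofGen {X Y : FreeCat E G V} (p : {v // v ∈ X.vars} → (W E G Y.vars).carrier)
    (v : {v // v ∈ X.vars}) : app (ofGen p) (free.gen v) = p v := free.lift_gen p v

/-- An isomorphism of `(Θ^G)⁰`, as an isomorphism of algebras. -/
noncomputable def isoEquiv {X Y : FreeCat E G V} (e : X ≅ Y) :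
    (W E G X.vars).carrier ≃[L] (W E G Y.vars).carrier where
  toFun := app e.hom
  invFun := app e.inv
  left_inv a := by rw [← app_comp, e.hom_inv_id, app_id]
  right_inv a := by rw [← app_comp, e.inv_hom_id, app_id]
  map_fun' F a := app_funMap e.hom F a
  map_rel' r := isEmptyElim r

/-- Free algebras over equally many generators are isomorphic. -/
theorem nonempty_iso_of_card_eq {X Y : FreeCat E G V} (h : X.vars.card = Y.vars.card) :
    Nonempty (X ≅ Y) := by
  let e := Finset.equivOfCardEq h
  refine ⟨⟨ofGen fun v => free.gen (e v), ofGen fun v => free.gen (e.symm v), ?_, ?_⟩⟩ <;>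
  · refine hom_ext_gen fun v => ?_
    rw [app_comp, app_id, app_ofGen, app_ofGen]
    simp

section Point

variable {x : V}

/-- The free generator of `W(x)`. -/
def gen (x : V) : (W E G (oneGen E G x).vars).carrier :=
  free.gen (⟨x, Finset.mem_singleton_self x⟩ : {v // v ∈ (oneGen E G x).vars})

theorem hom_ext_oneGen {X : FreeCat E G V} {f g : oneGen E G x ⟶ X}
    (h : app f (gen x) = app g (gen x)) : f = g :=
  hom_ext_gen fun ⟨v, hv⟩ => by
    obtain rfl := Finset.mem_singleton.1 hv
    exact h

/-- The element `w` of `W(X)`, as the morphism `W(x) → W(X)` that takes `x` to `w`. -/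
noncomputable def point (x : V) {X : FreeCat E G V} (w : (W E G X.vars).carrier) :
    oneGen E G x ⟶ X := ofGen fun _ => w

@[simp]
theorem app_point {X : FreeCat E G V} (w : (W E G X.vars).carrier) :
    app (point x w) (gen x) = w := app_ofGen _ _

theorem point_app {X Y : FreeCat E G V} (ν : X ⟶ Y) (w : (W E G X.vars).carrier) :
    point x (app ν w) = point x w ≫ ν :=
  hom_ext_oneGen <| by rw [app_comp, app_point, app_point]

theorem point_app_gen {X : FreeCat E G V} (ν : oneGen E G x ⟶ X) : point x (app ν (gen x)) = ν :=
  hom_ext_oneGen <| app_point _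

end Point

end FreeCat

open FreeCat

/-- The automorphism `φ` of `(Θ^G)⁰` is given by the semi-isomorphisms `s_W` over `σ`. -/
def SemiInnerBy (φ : IsoCat (FreeCat E G V) (FreeCat E G V)) (σ : G ≃[L] G)
    (s : ∀ X : FreeCat E G V,
      (W E G X.vars).carrier ≃[L] (W E G (φ.functor.obj X).vars).carrier) : Prop :=
  (∀ X, IsOver σ (s X)) ∧ ∀ {X Y : FreeCat E G V} (ν : X ⟶ Y) (a : (W E G X.vars).carrier),
    app (φ.functor.map ν) (s X a) = s Y (app ν a)

theorem SemiInnerBy.isSemiInner {φ : IsoCat (FreeCat E G V) (FreeCat E G V)} {σ : G ≃[L] G}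
    {s : ∀ X : FreeCat E G V,
      (W E G X.vars).carrier ≃[L] (W E G (φ.functor.obj X).vars).carrier}
    (h : SemiInnerBy φ σ s) : IsSemiInner φ := ⟨σ, s, h⟩

/-- Semi-isomorphisms over the identity of `G` are isomorphisms of `G`-algebras. -/
theorem SemiInnerBy.isInner {φ : IsoCat (FreeCat E G V) (FreeCat E G V)}
    {s : ∀ X : FreeCat E G V,
      (W E G X.vars).carrier ≃[L] (W E G (φ.functor.obj X).vars).carrier}
    (h : SemiInnerBy φ (FirstOrder.Language.Equiv.refl L G) s) : IsInner φ := by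
  let e (X : FreeCat E G V) : X ≅ φ.functor.obj X :=
    { hom := (⟨(s X).toHom, h.1 X⟩ : GHom (W E G X.vars) (W E G (φ.functor.obj X).vars))
      inv := (⟨(s X).symm.toHom, (h.1 X).symm⟩ :
        GHom (W E G (φ.functor.obj X).vars) (W E G X.vars))
      hom_inv_id := hom_ext (s X).symm_apply_apply
      inv_hom_id := hom_ext (s X).apply_symm_apply }
  refine ⟨e, fun {X Y} ν => ?_⟩
  rw [Iso.eq_inv_comp]
  exact hom_ext (h.2 ν)

/-- If `φ` takes `W(x)` to an isomorphic copy, and the automorphism of `End W(x)` that `φ` induces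
through such an isomorphism is always given by a semiautomorphism of `W(x)`, over an automorphism
`σ` of `G` with the property `P`, then `φ` itself is given by semi-isomorphisms over such a `σ`. -/
theorem exists_semiInnerBy [Nonempty G] {hG : Satisfies E G} (hstar : ConditionStar hG V) {x : V}
    {P : (G ≃[L] G) → Prop}
    (hx : ∀ ψ : End (oneGen E G x) ≃* End (oneGen E G x), ∃ σ s, P σ ∧ GivenBy ψ σ s)
    (φ : IsoCat (FreeCat E G V) (FreeCat E G V))
    (hφ : Nonempty (φ.functor.obj (oneGen E G x) ≅ oneGen E G x)) :
    ∃ σ s, P σ ∧ SemiInnerBy φ σ s := by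
  obtain ⟨θ⟩ := hφ
  obtain ⟨σ, r, hσ, hr, hψ⟩ := hx
    ((Functor.FullyFaithful.ofFullyFaithful φ.functor).mulEquivEnd _ |>.trans θ.conj)
  let s : (W E G (oneGen E G x).vars).carrier ≃[L]
      (W E G (φ.functor.obj (oneGen E G x)).vars).carrier := (isoEquiv θ.symm).comp r
  have hs : IsOver σ s := fun g => (congrArg (app θ.inv) (hr g)).trans (app_const θ.inv _)
  have hconj (ν : oneGen E G x ⟶ oneGen E G x) (a) :
      app (φ.functor.map ν) (s a) = s (app ν a) := by
    have h : app θ.hom (app (φ.functor.map ν) (s a)) = r (app ν a) := hψ ν a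
    have h' := congrArg (app θ.inv) h
    rwa [← app_comp, θ.hom_inv_id, app_id] at h'
  -- A morphism from `φ(W(x))` is determined by its value at `s x`, which is arbitrary.
  have hgen {X : FreeCat E G V} (u : (W E G X.vars).carrier) :
      ∃! μ : φ.functor.obj (oneGen E G x) ⟶ X, app μ (s (gen x)) = u := by
    obtain ⟨μ, hμ, hu⟩ := free.existsUnique_lift_of_isOver (H := W E G X.vars) hs fun _ => u
    refine ⟨μ, hμ _, fun μ' h => hu μ' fun ⟨v, hv⟩ => ?_⟩
    obtain rfl := Finset.mem_singleton.1 hv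
    exact h
  -- The bijection `W(X) = Hom(W(x), W(X)) → Hom(φ W(x), φ W(X)) = φ W(X)`.
  let t (X : FreeCat E G V) (w : (W E G X.vars).carrier) :
      (W E G (φ.functor.obj X).vars).carrier := app (φ.functor.map (point x w)) (s (gen x))
  have hnat {X Y : FreeCat E G V} (ν : X ⟶ Y) (w) :
      app (φ.functor.map ν) (t X w) = t Y (app ν w) := by
    simp only [t, point_app, Functor.map_comp, app_comp]
  have hone (w) : t (oneGen E G x) w = s w := by
    simp only [t, hconj, app_point]
  have hbij (X) : Function.Bijective (t X) := by
    refine ⟨fun w w' h => ?_, fun u => ?_⟩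
    · have := φ.functor.map_injective ((hgen _).unique h rfl)
      rw [← app_point (x := x) w, this, app_point]
    · obtain ⟨μ, hμ, -⟩ := hgen u
      obtain ⟨ν, rfl⟩ := φ.functor.map_surjective μ
      exact ⟨app ν (gen x), by simpa only [t, point_app_gen] using hμ⟩
  -- Morphisms to `φ(W(x))` separate elements, so that `t X` inherits its compatibility with the
  -- operations and with the constants from `t (W(x)) = s`.
  have hsep {X : FreeCat E G V} {u u' : (W E G (φ.functor.obj X).vars).carrier}
      (h : ∀ ν : X ⟶ oneGen E G x, app (φ.functor.map ν) u = app (φ.functor.map ν) u') :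
      u = u' := by
    refine hstar.eq_of_forall_hom
      (free.faithful hG (X := {v // v ∈ (φ.functor.obj (oneGen E G x)).vars})) fun μ => ?_
    obtain ⟨ν, hν⟩ := φ.functor.map_surjective
      (show φ.functor.obj X ⟶ φ.functor.obj (oneGen E G x) from μ)
    have := h ν
    rwa [hν] at this
  refine ⟨σ, fun X => ⟨Equiv.ofBijective (t X) (hbij X), fun F a => ?_, fun R => isEmptyElim R⟩,
    hσ, fun X g => ?_, fun ν a => hnat ν a⟩
  · refine hsep fun ν => ?_
    change app (φ.functor.map ν) (t X _) =
      app (φ.functor.map ν) (Structure.funMap F fun i => t X (a i))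
    simp only [hnat, app_funMap, hone]
    exact s.map_fun F _
  · refine hsep fun ν => ?_
    change app (φ.functor.map ν) (t X _) = _
    rw [hnat, app_const, hone, hs, app_const]

open Limits in
/-- If `Θ^G` is regular, then every automorphism `φ` of `(Θ^G)⁰` takes `W(x)` to an isomorphic copy:
let `φ(W(x)) = W(Y)` and `W(x) = φ(W(Z))`. As `W(Z)` is the coproduct of `|Z|` copies of `W(x)`,
`W(x)` is the coproduct of `|Z|` copies of `W(Y)`, and hence `|Y| * |Z| = 1`. -/
theorem RegularVariety.nonempty_iso [Infinite V] (hreg : RegularVariety E G V)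
    (φ : IsoCat (FreeCat E G V) (FreeCat E G V)) (x : V) :
    Nonempty (φ.functor.obj (oneGen E G x) ≅ oneGen E G x) := by
  obtain ⟨Z, hZ⟩ := (Functor.bijective_obj φ.functor).2 (oneGen E G x)
  set Y := φ.functor.obj (oneGen E G x) with hY
  let c : Cofan fun _ : {v // v ∈ Z.vars} => oneGen E G x :=
    Cofan.mk Z fun z => point x (free.gen z)
  have hc : IsColimit c := Cofan.IsColimit.mk _
    (fun d => ofGen fun z => app (d.inj z) (gen x))
    (fun d z => hom_ext_oneGen <| by
      change app (ofGen _) (app (point x (free.gen z)) (gen x)) = _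
      rw [app_point, app_ofGen])
    (fun d m hm => hom_ext_gen fun z => by
      rw [app_ofGen, ← hm z]
      change app m _ = app m (app (point x (free.gen z)) (gen x))
      rw [app_point])
  have : PreservesColimit (Discrete.functor fun _ : {v // v ∈ Z.vars} => oneGen E G x)
      φ.functor := inferInstance
  have hφc := isColimitCofanMkObjOfIsColimit φ.functor _ _ hc
  obtain ⟨U, hU⟩ := Infinite.exists_subset_card_eq V (Z.vars.card * Y.vars.card)
  let e : {v // v ∈ Z.vars} × {v // v ∈ Y.vars} ≃ {v // v ∈ U} :=
    Fintype.equivOfCardEq (by simp [hU])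
  let c' : Cofan fun _ : {v // v ∈ Z.vars} => Y :=
    Cofan.mk (⟨U⟩ : FreeCat E G V) fun z => ofGen fun y => free.gen (e (z, y))
  have hc' : IsColimit c' := Cofan.IsColimit.mk _
    (fun d => ofGen fun u => app (d.inj (e.symm u).1) (free.gen (e.symm u).2))
    (fun d z => hom_ext_gen fun y => by
      change app (ofGen _) (app (ofGen fun y => free.gen (e (z, y))) (free.gen y)) = _
      rw [app_ofGen, app_ofGen, e.symm_apply_apply])
    (fun d m hm => hom_ext_gen fun u => by
      rw [app_ofGen, ← hm]
      change _ = app m (app (ofGen fun y => free.gen (e (_, y))) (free.gen _))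
      rw [app_ofGen, e.apply_symm_apply])
  have hcard := hreg _ _ ⟨hφc.coconePointUniqueUpToIso hc'⟩
  change (φ.functor.obj Z).vars.card = U.card at hcard
  rw [hZ, hU] at hcard
  refine nonempty_iso_of_card_eq ?_
  have hone : (oneGen E G x).vars.card = 1 := Finset.card_singleton x
  rw [hone] at hcard ⊢
  exact Nat.eq_one_of_mul_eq_one_left hcard.symm

end Automorphisms

/-! ### Algebraic sets and geometric equivalence -/

section Geometry

variable {L : FirstOrder.Language.{uF, uR}} [L.IsAlgebraic] {E : Set (Identity L)} {G : Type uG}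
  [L.Structure G] {V : Type uV}

section Galois

variable {H : GAlgebra.{uF, uR, uG, uH} E G} {X : Finset V}

theorem subset_zeros_iff {A : Set (GHom (W E G X) H)}
    {T : Set ((W E G X).carrier × (W E G X).carrier)} : A ⊆ zeros H T ↔ T ⊆ equations A :=
  ⟨fun h _ ht _ hν => h hν _ ht, fun h _ hν _ ht => h ht _ hν⟩

theorem zeros_empty : zeros H (∅ : Set ((W E G X).carrier × (W E G X).carrier)) = Set.univ :=
  Set.eq_univ_of_forall fun _ _ ht => ht.elim

theorem AlgSet.zeros_equations (P : AlgSet V H) : zeros H (equations P.pts) = P.pts := by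
  obtain ⟨X, _, T, rfl⟩ := P
  refine Set.Subset.antisymm (fun ν hν t ht => hν t fun μ hμ => hμ t ht)
    (subset_zeros_iff.2 subset_rfl)

/-- The algebraic set of the solutions of the system of equations `T`. -/
def AlgSet.ofEquations (H : GAlgebra.{uF, uR, uG, uH} E G) {X : Finset V}
    (T : Set ((W E G X).carrier × (W E G X).carrier)) : AlgSet V H := ⟨X, zeros H T, T, rfl⟩

theorem AlgSet.ofEquations_equations (P : AlgSet V H) :
    AlgSet.ofEquations H (equations P.pts) = P := by
  have h := P.zeros_equations
  obtain ⟨X, A, hA⟩ := P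
  simp only [ofEquations, mk.injEq, heq_eq_eq, true_and]
  exact h

end Galois

variable {H₁ : GAlgebra.{uF, uR, uG, w₁} E G} {H₂ : GAlgebra.{uF, uR, uG, w₂} E G}
  {σ : G ≃[L] G}

/-- Semi-isomorphisms `H₁ → H₂` and `W(X) → W(Y)` over the same automorphism of `G` carry the
solutions, and so the consequences, of a system of equations over `H₁` to those over `H₂`. -/
theorem mem_equations_zeros_iff_of_isOver {μ : H₁.carrier ≃[L] H₂.carrier} (hμ : IsOver σ μ)
    {X Y : Finset V} {s : (W E G X).carrier ≃[L] (W E G Y).carrier} (hs : IsOver σ s)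
    (S : Set ((W E G Y).carrier × (W E G Y).carrier)) (a b : (W E G X).carrier) :
    (a, b) ∈ equations (zeros H₁ (Prod.map s s ⁻¹' S)) ↔
      (s a, s b) ∈ equations (zeros H₂ S) := by
  have hmem (ν : GHom (W E G X) H₁) :
      ν ∈ zeros H₁ (Prod.map s s ⁻¹' S) ↔ ν.conj hs hμ ∈ zeros H₂ S := by
    refine ⟨fun h => ?_, fun h t ht => ?_⟩
    · rintro ⟨c, d⟩ hcd
      obtain ⟨c, rfl⟩ := s.surjective c
      obtain ⟨d, rfl⟩ := s.surjective d
      rw [GHom.conj_apply, GHom.conj_apply]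
      exact congrArg μ (h (c, d) hcd)
    · have := h _ ht
      simp only [Prod.map_fst, Prod.map_snd, GHom.conj_apply] at this
      exact μ.injective this
  refine ⟨fun h ν' hν' => ?_, fun h ν hν => ?_⟩
  · obtain ⟨ν, rfl⟩ := GHom.exists_conj_eq hs hμ ν'
    simp only [GHom.conj_apply]
    exact congrArg μ (h ν ((hmem ν).2 hν'))
  · have := h _ ((hmem ν).1 hν)
    simp only [GHom.conj_apply] at this
    exact μ.injective this

theorem GeometricallyEquivalentUpToSemi.of_twist {H₁ H₂ : GAlgebra.{uF, uR, uG, w} E G}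
    (h : GeometricallyEquivalent V (H₁.twist σ.symm) H₂) :
    GeometricallyEquivalentUpToSemi V H₁ H₂ :=
  ⟨_, ⟨σ, _, H₁.isOver_untwist_symm σ⟩, h⟩

theorem GeometricallyEquivalent.upToSemi {H₁ H₂ : GAlgebra.{uF, uR, uG, w} E G}
    (h : GeometricallyEquivalent V H₁ H₂) : GeometricallyEquivalentUpToSemi V H₁ H₂ :=
  GeometricallyEquivalentUpToSemi.of_twist (σ := FirstOrder.Language.Equiv.refl L G) h

/-- The isomorphisms `s_X : W(X) → W(X)` identify the `H₁`-closed systems of equations with the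
`H₂`-closed ones, compatibly with the closure operators `T ↦ T''`. -/
def MatchesClosure (H₁ : GAlgebra.{uF, uR, uG, w₁} E G) (H₂ : GAlgebra.{uF, uR, uG, w₂} E G)
    (s : ∀ X : Finset V, (W E G X).carrier ≃[L] (W E G X).carrier) : Prop :=
  ∀ X S a b, (a, b) ∈ equations (zeros H₁ (Prod.map (s X) (s X) ⁻¹' S)) ↔
    (s X a, s X b) ∈ equations (zeros H₂ S)

theorem GeometricallyEquivalentUpToSemi.exists_isOver {H₁ H₂ : GAlgebra.{uF, uR, uG, w} E G}
    (h : GeometricallyEquivalentUpToSemi V H₁ H₂) :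
    ∃ (σ : G ≃[L] G) (s : ∀ X : Finset V, (W E G X).carrier ≃[L] (W E G X).carrier),
      (∀ X, IsOver σ (s X)) ∧ MatchesClosure H₁ H₂ s := by
  obtain ⟨H, ⟨σ, μ, hμ⟩, hH⟩ := h
  choose s hs using fun X : Finset V => free.exists_isOver E σ {v // v ∈ X}
  refine ⟨σ, s, hs, fun X S a b => ?_⟩
  rw [← hH]
  exact mem_equations_zeros_iff_of_isOver hμ (hs X) S a b

/-! ### The category of algebraic sets -/

namespace AlgSet

variable {H : GAlgebra.{uF, uR, uG, uH} E G}

/-- A homomorphism `r : W(Y) → W(X)` is admissible with respect to `A` and `B` if `ν r ∈ B` for all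
`ν ∈ A`. -/
def Admissible (P Q : AlgSet V H) (r : GHom (W E G Q.vars) (W E G P.vars)) : Prop :=
  ∀ ν ∈ P.pts, ν.comp r ∈ Q.pts

/-- The morphism `[r] : ν ↦ ν r`. -/
noncomputable def Admissible.hom {P Q : AlgSet V H} {r : GHom (W E G Q.vars) (W E G P.vars)}
    (h : Admissible P Q r) : P ⟶ Q := Hom.mk (fun ν => ⟨ν.1.comp r, h ν.1 ν.2⟩) ⟨r, fun _ => rfl⟩

theorem admissible_id (P : AlgSet V H) : Admissible P P (GHom.id _) := fun _ h => h

theorem Admissible.comp {P Q R : AlgSet V H} {r : GHom (W E G Q.vars) (W E G P.vars)}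
    {r' : GHom (W E G R.vars) (W E G Q.vars)} (h : Admissible P Q r) (h' : Admissible Q R r') :
    Admissible P R (r.comp r') := fun ν hν => h' _ (h ν hν)

theorem Admissible.hom_comp {P Q R : AlgSet V H} {r : GHom (W E G Q.vars) (W E G P.vars)}
    {r' : GHom (W E G R.vars) (W E G Q.vars)} (h : Admissible P Q r) (h' : Admissible Q R r') :
    h.hom ≫ h'.hom = (h.comp h').hom := rfl

theorem Admissible.hom_congr {P Q : AlgSet V H} {r r' : GHom (W E G Q.vars) (W E G P.vars)}
    (h : Admissible P Q r) (h' : Admissible P Q r') (e : r = r') : h.hom = h'.hom := by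
  subst e
  rfl

theorem exists_eq_hom {P Q : AlgSet V H} (f : P ⟶ Q) :
    ∃ r, ∃ h : Admissible P Q r, f = h.hom := by
  obtain ⟨f, r, hr⟩ := f
  refine ⟨r, fun ν hν => ?_, Hom.ext (funext fun ν => Subtype.ext (hr ν))⟩
  rw [← hr ⟨ν, hν⟩]
  exact (f _).2

theorem Admissible.hom_eq_iff {P Q : AlgSet V H} {r r' : GHom (W E G Q.vars) (W E G P.vars)}
    (h : Admissible P Q r) (h' : Admissible P Q r') :
    h.hom = h'.hom ↔ ∀ a, (r a, r' a) ∈ equations P.pts := by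
  refine ⟨fun e a ν hν => ?_, fun e => Hom.ext (funext fun ν => Subtype.ext (GHom.ext fun a => ?_))⟩
  · exact congrArg (fun f : AlgSet.Hom P Q => (f.map ⟨ν, hν⟩).1 a) e
  · exact e a ν.1 ν.2

/-- Admissibility in terms of the closed systems of equations. -/
theorem admissible_iff {P Q : AlgSet V H} {r : GHom (W E G Q.vars) (W E G P.vars)} :
    Admissible P Q r ↔ ∀ a b, (a, b) ∈ equations Q.pts → (r a, r b) ∈ equations P.pts := by
  refine ⟨fun h a b hab ν hν => hab _ (h ν hν), fun h ν hν => ?_⟩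
  rw [← Q.zeros_equations]
  exact fun t ht => h _ _ ht ν hν

end AlgSet

namespace AlgSet

variable {s : ∀ X : Finset V, (W E G X).carrier ≃[L] (W E G X).carrier}

/-- The image in `K(H₂)` of an algebraic set over `H₁` under isomorphisms of the free algebras:
the solutions over `H₂` of the image of its equations. -/
def transport (H₂ : GAlgebra.{uF, uR, uG, w₂} E G)
    (s : ∀ X : Finset V, (W E G X).carrier ≃[L] (W E G X).carrier) (P : AlgSet V H₁) :
    AlgSet V H₂ :=
  ofEquations H₂ (Prod.map (s P.vars).symm (s P.vars).symm ⁻¹' equations P.pts)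

theorem mem_equations_transport (h : MatchesClosure H₁ H₂ s) (P : AlgSet V H₁)
    (a b : (W E G P.vars).carrier) :
    (s P.vars a, s P.vars b) ∈ equations (P.transport H₂ s).pts ↔ (a, b) ∈ equations P.pts := by
  refine (h P.vars _ a b).symm.trans ?_
  have : Prod.map (s P.vars) (s P.vars) ⁻¹'
      (Prod.map (s P.vars).symm (s P.vars).symm ⁻¹' equations P.pts) = equations P.pts := by
    ext ⟨c, d⟩
    simp
  rw [this, P.zeros_equations]

theorem transport_bijective (h : MatchesClosure H₁ H₂ s) :
    Function.Bijective (transport H₂ s : AlgSet V H₁ → AlgSet V H₂) := by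
  refine ⟨fun P Q hPQ => ?_, fun Q => ?_⟩
  · have hP := mem_equations_transport h P
    have hQ := mem_equations_transport h Q
    obtain ⟨X, A, hA⟩ := P
    obtain ⟨Y, B, hB⟩ := Q
    obtain rfl : X = Y := congrArg AlgSet.vars hPQ
    have hpts : (transport H₂ s ⟨X, A, hA⟩).pts = (transport H₂ s ⟨X, B, hB⟩).pts :=
      eq_of_heq (AlgSet.mk.inj hPQ).2
    rw [← ofEquations_equations ⟨X, A, hA⟩, ← ofEquations_equations ⟨X, B, hB⟩]
    refine congrArg (ofEquations H₁ (X := X)) ?_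
    ext ⟨a, b⟩
    refine (hP a b).symm.trans (Iff.trans ?_ (hQ a b))
    exact iff_of_eq (congrArg (fun C => (s X a, s X b) ∈ equations C) hpts)
  · have hQ := Q.zeros_equations
    obtain ⟨X, B, hB⟩ := Q
    refine ⟨ofEquations H₁ (Prod.map (s X) (s X) ⁻¹' equations B), ?_⟩
    have hset : Prod.map (s X).symm (s X).symm ⁻¹'
        equations (zeros H₁ (Prod.map (s X) (s X) ⁻¹' equations B)) = equations B := by
      ext ⟨a, b⟩
      obtain ⟨a, rfl⟩ := (s X).surjective a
      obtain ⟨b, rfl⟩ := (s X).surjective b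
      simp only [Set.mem_preimage, Prod.map_apply, FirstOrder.Language.Equiv.symm_apply_apply]
      rw [h, hQ]
    refine (congrArg (ofEquations H₂ (X := X)) hset).trans (ofEquations_equations ⟨X, B, hB⟩)

theorem admissible_transport_iff (h : MatchesClosure H₁ H₂ s) (hs : ∀ X, IsOver σ (s X))
    {P Q : AlgSet V H₁} {r : GHom (W E G Q.vars) (W E G P.vars)} :
    Admissible (P.transport H₂ s) (Q.transport H₂ s) (r.conj (hs Q.vars) (hs P.vars)) ↔
      Admissible P Q r := by
  refine admissible_iff.trans (Iff.trans ?_ admissible_iff.symm)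
  refine (s Q.vars).surjective.forall.trans (forall_congr' fun a => ?_)
  refine (s Q.vars).surjective.forall.trans (forall_congr' fun b => ?_)
  have hP := mem_equations_transport h P (r a) (r b)
  rw [← GHom.conj_apply (hs Q.vars) (hs P.vars) r, ← GHom.conj_apply (hs Q.vars) (hs P.vars) r]
    at hP
  exact imp_congr (mem_equations_transport h Q a b) hP

theorem Admissible.hom_transport_eq_iff (h : MatchesClosure H₁ H₂ s) (hs : ∀ X, IsOver σ (s X))
    {P Q : AlgSet V H₁} {r r' : GHom (W E G Q.vars) (W E G P.vars)}
    (hr : Admissible P Q r) (hr' : Admissible P Q r') :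
    ((admissible_transport_iff h hs).2 hr).hom = ((admissible_transport_iff h hs).2 hr').hom ↔
      hr.hom = hr'.hom := by
  refine (hom_eq_iff _ _).trans (Iff.trans ?_ (hom_eq_iff _ _).symm)
  refine (s Q.vars).surjective.forall.trans (forall_congr' fun a => ?_)
  have hP := mem_equations_transport h P (r a) (r' a)
  rwa [← GHom.conj_apply (hs Q.vars) (hs P.vars) r, ← GHom.conj_apply (hs Q.vars) (hs P.vars) r']
    at hP

/-- The morphism `[s r s⁻¹]` of `K(H₂)` for a morphism `[r]` of `K(H₁)`; it does not depend on the
choice of `r`. -/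
noncomputable def transportMap (h : MatchesClosure H₁ H₂ s) (hs : ∀ X, IsOver σ (s X))
    {P Q : AlgSet V H₁} (f : P ⟶ Q) : P.transport H₂ s ⟶ Q.transport H₂ s :=
  ((admissible_transport_iff h hs).2 (exists_eq_hom f).choose_spec.choose).hom

theorem transportMap_hom (h : MatchesClosure H₁ H₂ s) (hs : ∀ X, IsOver σ (s X))
    {P Q : AlgSet V H₁} {r : GHom (W E G Q.vars) (W E G P.vars)} (hr : Admissible P Q r) :
    transportMap h hs hr.hom = ((admissible_transport_iff h hs).2 hr).hom :=
  (Admissible.hom_transport_eq_iff h hs _ hr).2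
    (exists_eq_hom hr.hom).choose_spec.choose_spec.symm

/-- The functor `K(H₁) → K(H₂)`, `[r] ↦ [s r s⁻¹]`. -/
noncomputable def transportFunctor (h : MatchesClosure H₁ H₂ s) (hs : ∀ X, IsOver σ (s X)) :
    AlgSet V H₁ ⥤ AlgSet V H₂ where
  obj P := P.transport H₂ s
  map f := transportMap h hs f
  map_id P := (transportMap_hom h hs (admissible_id P)).trans <|
    Admissible.hom_congr _ (admissible_id _) (GHom.conj_id (hs P.vars))
  map_comp {P Q R} f g := by
    obtain ⟨r, hr, rfl⟩ := exists_eq_hom f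
    obtain ⟨r', hr', rfl⟩ := exists_eq_hom g
    rw [Admissible.hom_comp, transportMap_hom, transportMap_hom, transportMap_hom,
      Admissible.hom_comp]
    exact Admissible.hom_congr _ _ (GHom.conj_comp (hs R.vars) (hs Q.vars) (hs P.vars) r' r)

theorem isIso_transportFunctor (h : MatchesClosure H₁ H₂ s) (hs : ∀ X, IsOver σ (s X)) :
    (transportFunctor h hs).IsIso where
  faithful := ⟨fun {P Q} f g hfg => by
    obtain ⟨r, hr, rfl⟩ := exists_eq_hom f
    obtain ⟨r', hr', rfl⟩ := exists_eq_hom g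
    refine (Admissible.hom_transport_eq_iff h hs hr hr').1 ?_
    exact (transportMap_hom h hs hr).symm.trans (hfg.trans (transportMap_hom h hs hr'))⟩
  full := ⟨fun {P Q} f' => by
    obtain ⟨r', hr', rfl⟩ := exists_eq_hom f'
    obtain ⟨r, rfl⟩ := GHom.exists_conj_eq (hs Q.vars) (hs P.vars) r'
    exact ⟨_, transportMap_hom h hs ((admissible_transport_iff h hs).1 hr')⟩⟩
  bijective_obj := transport_bijective h

theorem transport_affine (h : MatchesClosure H₁ H₂ s) (X : Finset V) :
    (affine H₁ X).transport H₂ s = affine H₂ X := by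
  have hset : Prod.map (s X).symm (s X).symm ⁻¹'
      equations (Set.univ : Set (GHom (W E G X) H₁)) =
        equations (Set.univ : Set (GHom (W E G X) H₂)) := by
    ext ⟨a, b⟩
    obtain ⟨a, rfl⟩ := (s X).surjective a
    obtain ⟨b, rfl⟩ := (s X).surjective b
    have := h X ∅ a b
    rw [Set.preimage_empty, zeros_empty, zeros_empty] at this
    simpa using this
  exact (congrArg (ofEquations H₂ (X := X)) hset).trans (ofEquations_equations (affine H₂ X))

theorem isIdentityEmbedding_hom {P : AlgSet V H₂} {Q : AlgSet V H₂} (hQ : Q = affine H₂ P.vars)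
    {r : GHom (W E G Q.vars) (W E G P.vars)} (hr : Admissible P Q r)
    (h : HEq r (GHom.id (W E G P.vars))) : IsIdentityEmbedding hr.hom := by
  subst hQ
  obtain rfl := eq_of_heq h
  exact .incl P

/-- Matching the closed systems of equations by semi-isomorphisms gives a correct isomorphism. -/
theorem correctlyIsomorphic_of_matchesClosure (h : MatchesClosure H₁ H₂ s)
    (hs : ∀ X, IsOver σ (s X)) : CorrectlyIsomorphic V H₁ H₂ := by
  have := isIso_transportFunctor h hs
  refine ⟨(transportFunctor h hs).asIsomorphism, fun X => ⟨X, rfl, transport_affine h X⟩,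
    fun P => ?_⟩
  have hr : Admissible P (affine H₁ P.vars) (GHom.id (W E G P.vars)) := fun _ _ => trivial
  have hmap : transportMap h hs P.incl = _ := transportMap_hom h hs hr
  change IsIdentityEmbedding (transportMap h hs P.incl)
  rw [hmap]
  exact isIdentityEmbedding_hom (P := P.transport H₂ s) (transport_affine h P.vars) _
    (heq_of_eq (GHom.conj_id (hs P.vars)))

end AlgSet
end Geometry

/-! ### From correct isomorphisms to automorphisms of the category of free algebras -/

/-- Let `A₁` and `A₂` embed `C` as full subcategories of `K₁` and `K₂`. An isomorphism `K₁ → K₂`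
that identifies the two subcategories restricts to an automorphism of `C`. -/
theorem exists_isoCat_of_embeddings {C K₁ K₂ : Type*} [Category C] [Category K₁] [Category K₂]
    (A₁ : C ⥤ K₁) [A₁.Full] [A₁.Faithful] (h₁ : Function.Injective A₁.obj)
    (A₂ : C ⥤ K₂) [A₂.Full] [A₂.Faithful] (h₂ : Function.Injective A₂.obj)
    (F : IsoCat K₁ K₂) (hF : ∀ X, ∃ Y, F.functor.obj (A₁.obj X) = A₂.obj Y)
    (hF' : ∀ Y, ∃ X, F.functor.obj (A₁.obj X) = A₂.obj Y) :
    ∃ φ : IsoCat C C, φ.functor ⋙ A₂ = A₁ ⋙ F.functor := by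
  choose f hf using hF
  let Φ : C ⥤ C :=
    { obj := f
      map := fun {X Y} ν => A₂.preimage
        (eqToHom (hf X).symm ≫ F.functor.map (A₁.map ν) ≫ eqToHom (hf Y))
      map_id := fun X => A₂.map_injective (by simp)
      map_comp := fun μ ν => A₂.map_injective (by simp) }
  have hΦ : Φ ⋙ A₂ = A₁ ⋙ F.functor :=
    CategoryTheory.Functor.ext (fun X => (hf X).symm) fun X Y ν => A₂.map_preimage _
  have : Φ.IsIso :=
    { faithful := by
        have : (Φ ⋙ A₂).Faithful := hΦ ▸ inferInstance
        exact Functor.Faithful.of_comp Φ A₂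
      full := by
        have : (Φ ⋙ A₂).Full := hΦ ▸ inferInstance
        exact Functor.Full.of_comp_faithful Φ A₂
      bijective_obj := by
        refine ⟨fun X Y hXY => ?_, fun Y => ?_⟩
        · refine h₁ ((Functor.bijective_obj F.functor).1 ?_)
          rw [hf, hf]
          exact congrArg A₂.obj hXY
        · obtain ⟨X, hX⟩ := hF' Y
          exact ⟨X, h₂ ((hf X).symm.trans hX)⟩ }
  exact ⟨Φ.asIsomorphism, hΦ⟩

/-- An automorphism of the opposite category, as an automorphism of the category. -/
theorem exists_isoCat_unop {C : Type*} [Category C] (φ : IsoCat Cᵒᵖ Cᵒᵖ) :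
    ∃ φ' : IsoCat C C, φ'.functor = φ.functor.unop := by
  have : φ.functor.unop.IsIso :=
    { faithful := ⟨fun h => Quiver.Hom.op_inj (φ.functor.map_injective (Quiver.Hom.unop_inj h))⟩
      full := ⟨fun {X Y} f => by
        obtain ⟨g, hg⟩ := φ.functor.map_surjective f.op
        exact ⟨g.unop, congrArg Quiver.Hom.unop hg⟩⟩
      bijective_obj := by
        refine ⟨fun X Y h => ?_, fun Y => ?_⟩
        · exact Opposite.op_injective ((Functor.bijective_obj φ.functor).1
            (Opposite.unop_injective h))
        · obtain ⟨X, hX⟩ := (Functor.bijective_obj φ.functor).2 (Opposite.op Y)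
          exact ⟨X.unop, congrArg Opposite.unop hX⟩ }
  exact ⟨φ.functor.unop.asIsomorphism, rfl⟩

section Correct

variable {L : FirstOrder.Language.{uF, uR}} [L.IsAlgebraic] {E : Set (Identity L)} {G : Type uG}
  [L.Structure G] {V : Type uV}

namespace AlgSet

variable {H : GAlgebra.{uF, uR, uG, uH} E G}

theorem IsIdentityEmbedding.exists_eq {P Q : AlgSet V H} {f : P ⟶ Q} (hf : IsIdentityEmbedding f) :
    ∃ h : affine H P.vars = Q, f = P.incl ≫ eqToHom h := by
  cases hf
  exact ⟨rfl, (Category.comp_id _).symm⟩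

/-- The affine spaces over `H`, as a contravariant functor of the free algebras. -/
noncomputable def affineFunctor (H : GAlgebra.{uF, uR, uG, uH} E G) (V : Type uV) :
    (FreeCat E G V)ᵒᵖ ⥤ AlgSet V H where
  obj X := affine H X.unop.vars
  map {X Y} f := Admissible.hom (P := affine H X.unop.vars) (Q := affine H Y.unop.vars)
    (r := f.unop) fun _ _ => trivial
  map_id _ := rfl
  map_comp _ _ := rfl

theorem affineFunctor_obj_injective :
    Function.Injective (affineFunctor H V).obj := by
  intro X Y h
  have h' : X.unop.vars = Y.unop.vars := congrArg AlgSet.vars h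
  induction X with | op X => induction Y with | op Y =>
  obtain ⟨X⟩ := X
  obtain ⟨Y⟩ := Y
  obtain rfl : X = Y := h'
  rfl

instance : (affineFunctor H V).Full where
  map_surjective {X Y} f := by
    obtain ⟨r, hr, rfl⟩ := exists_eq_hom f
    exact ⟨Quiver.Hom.op (X := Y.unop) (Y := X.unop) r, rfl⟩

theorem faithful_affineFunctor {hG : Satisfies E G} (hstar : ConditionStar hG V)
    (hH : H.Faithful) : (affineFunctor H V).Faithful where
  map_injective {X Y} _ _ hfg := Quiver.Hom.unop_inj <| FreeCat.hom_ext fun a =>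
    hstar.eq_of_forall_hom hH fun μ =>
      congrArg (fun h : AlgSet.Hom (affine H X.unop.vars) (affine H Y.unop.vars) =>
        (h.map ⟨μ, trivial⟩).1 a) hfg

/-- The identity embedding of `(X, A)`, as a morphism to the value of the functor of affine
spaces. -/
noncomputable def toAffine (X : FreeCat E G V) (A : Set (GHom (W E G X.vars) H))
    (hA : ∃ T, A = zeros H T) :
    (⟨X.vars, A, hA⟩ : AlgSet V H) ⟶ (affineFunctor H V).obj (Opposite.op X) := incl _

/-- Equations of an algebraic set, read off from the composites of its embedding into the affine
space with morphisms of affine spaces. -/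
theorem toAffine_comp_eq_iff {X : FreeCat E G V} {A : Set (GHom (W E G X.vars) H)}
    {hA : ∃ T, A = zeros H T} {Y : FreeCat E G V} (r r' : Y ⟶ X) :
    toAffine X A hA ≫ (affineFunctor H V).map r.op =
        toAffine X A hA ≫ (affineFunctor H V).map r'.op ↔
      ∀ a, (FreeCat.app r a, FreeCat.app r' a) ∈ equations A :=
  Admissible.hom_eq_iff (P := ⟨X.vars, A, hA⟩) (Q := affine H Y.vars) (r := r) (r' := r')
    (fun _ _ => trivial) fun _ _ => trivial

theorem IsIdentityEmbedding.comp_eq_iff {Q Z : AlgSet V H} {f : Q ⟶ Z}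
    (hf : IsIdentityEmbedding f) {U : FreeCat E G V}
    (hZ : Z = (affineFunctor H V).obj (Opposite.op U)) :
    ∃ B hB, Q = ⟨U.vars, B, hB⟩ ∧ ∀ {Y : FreeCat E G V} (r r' : Y ⟶ U),
      f ≫ eqToHom hZ ≫ (affineFunctor H V).map r.op =
          f ≫ eqToHom hZ ≫ (affineFunctor H V).map r'.op ↔
        ∀ a, (FreeCat.app r a, FreeCat.app r' a) ∈ equations B := by
  obtain ⟨h, rfl⟩ := hf.exists_eq
  subst h
  obtain ⟨X, B, hB⟩ := Q
  obtain ⟨U⟩ := U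
  obtain rfl : X = U := congrArg AlgSet.vars hZ
  refine ⟨B, hB, rfl, fun r r' => ?_⟩
  simp only [eqToHom_refl, Category.comp_id]
  exact toAffine_comp_eq_iff (X := ⟨X⟩) (hA := hB) r r'

end AlgSet

open AlgSet FreeCat

variable {H₁ : GAlgebra.{uF, uR, uG, w₁} E G} {H₂ : GAlgebra.{uF, uR, uG, w₂} E G}
  {σ : G ≃[L] G}

/-- A correct isomorphism also reflects affine spaces, since it preserves the target of the identity
embedding of their preimages. -/
theorem IsCorrect.exists_affine_eq {F : IsoCat (AlgSet V H₁) (AlgSet V H₂)} (hF : IsCorrect F)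
    (Y : Finset V) : ∃ X, F.functor.obj (affine H₁ X) = affine H₂ Y := by
  obtain ⟨P, hP⟩ := (Functor.bijective_obj F.functor).2 (affine H₂ Y)
  obtain ⟨h, -⟩ := (hF.2 P).exists_eq
  rw [hP] at h
  exact ⟨P.vars, h.symm⟩

/-- A correct isomorphism restricts to an automorphism `φ` of `(Θ^G)⁰` on the affine spaces; `φ`
preserves the number of generators. -/
theorem IsCorrect.exists_isoCat {F : IsoCat (AlgSet V H₁) (AlgSet V H₂)} (hF : IsCorrect F)
    {hG : Satisfies E G} (hstar : ConditionStar hG V) (h₁ : H₁.Faithful) (h₂ : H₂.Faithful) :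
    ∃ φ : IsoCat (FreeCat E G V) (FreeCat E G V),
      (∀ X, (φ.functor.obj X).vars.card = X.vars.card) ∧
        φ.functor.op ⋙ affineFunctor H₂ V = affineFunctor H₁ V ⋙ F.functor := by
  have := faithful_affineFunctor hstar h₁
  have := faithful_affineFunctor hstar h₂
  obtain ⟨φ, hφ⟩ := exists_isoCat_of_embeddings (affineFunctor H₁ V) affineFunctor_obj_injective
    (affineFunctor H₂ V) affineFunctor_obj_injective F
    (fun X => by
      obtain ⟨Y, -, hY⟩ := hF.1 X.unop.vars
      exact ⟨Opposite.op ⟨Y⟩, hY⟩)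
    (fun Y => by
      obtain ⟨X, hX⟩ := hF.exists_affine_eq Y.unop.vars
      exact ⟨Opposite.op ⟨X⟩, hX⟩)
  obtain ⟨φ', hφ'⟩ := exists_isoCat_unop φ
  have hcomp : φ'.functor.op ⋙ affineFunctor H₂ V = affineFunctor H₁ V ⋙ F.functor := by
    rw [hφ', ← hφ]
    rfl
  refine ⟨φ', fun X => ?_, hcomp⟩
  obtain ⟨Y, hY, hXY⟩ := hF.1 X.vars
  have h : affine H₂ (φ'.functor.obj X).vars = affine H₂ Y :=
    (Functor.congr_obj hcomp (Opposite.op X)).trans hXY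
  rw [← hY, show (φ'.functor.obj X).vars = Y from congrArg AlgSet.vars h]

/-- An equality of two morphisms from a copy of `W(x)` modulo a system of the form `A'` can be tested
at the generator. -/
theorem forall_mem_equations_iff {H : GAlgebra.{uF, uR, uG, uH} E G} {x : V} {X Y : FreeCat E G V}
    {s : (W E G (oneGen E G x).vars).carrier ≃[L] (W E G Y.vars).carrier} (hs : IsOver σ s)
    {A : Set (GHom (W E G X.vars) H)} {r r' : Y ⟶ X} :
    (∀ c, (app r c, app r' c) ∈ equations A) ↔
      (app r (s (gen x)), app r' (s (gen x))) ∈ equations A := by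
  refine ⟨fun h => h _, fun h c ν hν => ?_⟩
  obtain ⟨μ, -, hμ⟩ := free.existsUnique_lift_of_isOver (H := H) hs fun _ => ν (app r (s (gen x)))
  have key : GHom.comp ν r = GHom.comp ν r' := by
    refine (hμ _ fun ⟨v, hv⟩ => ?_).trans (hμ _ fun ⟨v, hv⟩ => ?_).symm
    · obtain rfl := Finset.mem_singleton.1 hv
      rfl
    · obtain rfl := Finset.mem_singleton.1 hv
      exact (h ν hν).symm
  exact congrArg (fun κ : GHom (W E G Y.vars) H => κ c) key

/-- If `φ` is given by the semi-isomorphisms `s_W`, then the equations of `F(X, A)` are the images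
under `s_{W(X)}` of those of `(X, A)`: an equation `w = w'` holds on `A` if and only if the
morphisms to the affine line given by `w` and `w'` agree on `A`. -/
theorem IsCorrect.exists_equations_iff {F : IsoCat (AlgSet V H₁) (AlgSet V H₂)} (hF : IsCorrect F)
    {φ : IsoCat (FreeCat E G V) (FreeCat E G V)}
    (hφ : φ.functor.op ⋙ affineFunctor H₂ V = affineFunctor H₁ V ⋙ F.functor)
    {s : ∀ X : FreeCat E G V,
      (W E G X.vars).carrier ≃[L] (W E G (φ.functor.obj X).vars).carrier}
    (hs : SemiInnerBy φ σ s) (x : V) (X : FreeCat E G V) (A : Set (GHom (W E G X.vars) H₁))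
    (hA : ∃ T, A = zeros H₁ T) :
    ∃ B hB, F.functor.obj ⟨X.vars, A, hA⟩ = ⟨(φ.functor.obj X).vars, B, hB⟩ ∧
      ∀ a b, (a, b) ∈ equations A ↔ (s X a, s X b) ∈ equations B := by
  have hZ := (Functor.congr_obj hφ (Opposite.op X)).symm
  have hι : IsIdentityEmbedding (F.functor.map (toAffine X A hA)) := hF.2 ⟨X.vars, A, hA⟩
  obtain ⟨B, hB, hP, h⟩ := hι.comp_eq_iff (U := φ.functor.obj X) hZ
  refine ⟨B, hB, hP, fun a b => ?_⟩
  have hmap (w : (W E G X.vars).carrier) :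
      F.functor.map (toAffine X A hA ≫ (affineFunctor H₁ V).map (point x w).op) =
        (F.functor.map (toAffine X A hA) ≫ eqToHom hZ ≫
          (affineFunctor H₂ V).map (φ.functor.map (point x w)).op) ≫
            eqToHom (Functor.congr_obj hφ (Opposite.op (oneGen E G x))) := by
    have hw := Functor.congr_hom hφ.symm (point x w).op
    rw [Functor.comp_map] at hw
    rw [Functor.map_comp, hw, Category.assoc, Category.assoc]
    rfl
  have hleft := toAffine_comp_eq_iff (hA := hA) (point x a) (point x b)
  rw [forall_mem_equations_iff (isOver_refl _)] at hleft
  have hright := h (φ.functor.map (point x a)) (φ.functor.map (point x b))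
  rw [forall_mem_equations_iff (hs.1 (oneGen E G x)), hs.2, hs.2, app_point, app_point] at hright
  rw [← hright, ← cancel_mono (eqToHom (Functor.congr_obj hφ (Opposite.op (oneGen E G x)))),
    ← hmap, ← hmap, F.functor.map_injective.eq_iff, hleft, FirstOrder.Language.Equiv.refl_apply,
    app_point, app_point]

/-- If `F` restricts to an automorphism of `(Θ^G)⁰` given by semi-isomorphisms over `σ`, then `H₁`,
with its structure map twisted by `σ`, is geometrically equivalent to `H₂`. -/
theorem IsCorrect.geometricallyEquivalent_twist {F : IsoCat (AlgSet V H₁) (AlgSet V H₂)}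
    (hF : IsCorrect F) {φ : IsoCat (FreeCat E G V) (FreeCat E G V)}
    (hφ : φ.functor.op ⋙ affineFunctor H₂ V = affineFunctor H₁ V ⋙ F.functor)
    {s : ∀ X : FreeCat E G V,
      (W E G X.vars).carrier ≃[L] (W E G (φ.functor.obj X).vars).carrier}
    (hs : SemiInnerBy φ σ s) (x : V) : GeometricallyEquivalent V (H₁.twist σ.symm) H₂ := by
  intro U S
  obtain ⟨X, hX⟩ := (Functor.bijective_obj φ.functor).2 ⟨U⟩
  obtain rfl : (φ.functor.obj X).vars = U := congrArg FreeCat.vars hX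
  have hclosure (a b : (W E G X.vars).carrier) :
      (a, b) ∈ equations (zeros H₁ (Prod.map (s X) (s X) ⁻¹' S)) ↔
        (s X a, s X b) ∈ equations (zeros H₂ S) := by
    refine ⟨fun h => ?_, fun h => ?_⟩
    -- Compare with the preimage under `F` of the algebraic set defined by `S`.
    · obtain ⟨⟨Y, A, hA⟩, hP⟩ := (Functor.bijective_obj F.functor).2 (AlgSet.ofEquations H₂ S)
      obtain ⟨B, hB, hPB, hiff⟩ := hF.exists_equations_iff hφ hs x ⟨Y⟩ A hA
      have hSB := hP.symm.trans hPB
      obtain rfl : ⟨Y⟩ = X := (Functor.bijective_obj φ.functor).1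
        (congrArg FreeCat.mk (congrArg AlgSet.vars hSB).symm)
      obtain rfl : zeros H₂ S = B := eq_of_heq (AlgSet.mk.inj hSB).2
      refine (hiff a b).1 fun ν hν => h ν fun t ht => ?_
      exact (hiff t.1 t.2).2 (fun μ hμ => hμ _ ht) ν hν
    -- Compare with the image under `F` of the algebraic set defined by the preimage of `S`.
    · obtain ⟨B, hB, -, hiff⟩ := hF.exists_equations_iff hφ hs x X _ ⟨_, rfl⟩
      refine (hiff a b).2 fun ν hν => h ν ?_
      rintro ⟨c, d⟩ hcd
      obtain ⟨c, rfl⟩ := (s X).surjective c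
      obtain ⟨d, rfl⟩ := (s X).surjective d
      exact (hiff c d).1 (fun μ hμ => hμ _ hcd) ν hν
  ext ⟨a, b⟩
  obtain ⟨a, rfl⟩ := (s X).surjective a
  obtain ⟨b, rfl⟩ := (s X).surjective b
  rw [← hclosure]
  exact (mem_equations_zeros_iff_of_isOver (H₁.isOver_untwist_symm σ) (hs.1 X) S a b).symm

/-- If all automorphisms of `End W(x)` are given by semiautomorphisms over automorphisms of `G` with
the property `P`, then correctly isomorphic faithful `G`-algebras become geometrically equivalent
after a twist by such an automorphism. -/
theorem CorrectlyIsomorphic.exists_twist [Nonempty G] {hG : Satisfies E G}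
    (hstar : ConditionStar hG V) {x : V} {P : (G ≃[L] G) → Prop}
    (hx : ∀ ψ : End (oneGen E G x) ≃* End (oneGen E G x), ∃ σ s, P σ ∧ GivenBy ψ σ s)
    (h₁ : H₁.Faithful) (h₂ : H₂.Faithful) (h : CorrectlyIsomorphic V H₁ H₂) :
    ∃ σ, P σ ∧ GeometricallyEquivalent V (H₁.twist σ.symm) H₂ := by
  obtain ⟨F, hF⟩ := h
  obtain ⟨φ, hcard, hφ⟩ := hF.exists_isoCat hstar h₁ h₂
  obtain ⟨σ, s, hσ, hs⟩ := exists_semiInnerBy hstar hx φ (nonempty_iso_of_card_eq (hcard _))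
  exact ⟨σ, hσ, hF.geometricallyEquivalent_twist hφ hs x⟩

end Correct
end UniversalAG

theorem mainTheorem2 {L : FirstOrder.Language} [L.IsAlgebraic]
    (E : Set (Identity L)) (G : Type*) [L.Structure G] [Nontrivial G]
    (hG : Satisfies E G) (V : Type*) [Infinite V] (x : V)
    (hstar : ConditionStar hG V) :
    -- automorphisms of the category of finitely generated free algebras
    (EndPerfect E G x →
      (∀ φ : IsoCat (FreeCat E G V) (FreeCat E G V),
        Nonempty (φ.functor.obj (oneGen E G x) ≅ oneGen E G x) →
          IsInner φ) ∧
      (RegularVariety E G V → VarietyPerfect E G V)) ∧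
    (EndSemiperfect E G x →
      (∀ φ : IsoCat (FreeCat E G V) (FreeCat E G V),
        Nonempty (φ.functor.obj (oneGen E G x) ≅ oneGen E G x) →
          IsSemiInner φ) ∧
      (RegularVariety E G V → VarietySemiperfect E G V)) ∧
    -- categories of algebraic sets over faithful algebras
    (∀ H₁ H₂ : GAlgebra E G, H₁.Faithful → H₂.Faithful →
      (EndSemiperfect E G x →
        (CorrectlyIsomorphic V H₁ H₂ ↔
          GeometricallyEquivalentUpToSemi V H₁ H₂)) ∧
      (EndPerfect E G x →
        (CorrectlyIsomorphic V H₁ H₂ ↔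
          GeometricallyEquivalent V H₁ H₂))) := by
  have hperfect (h : EndPerfect E G x) (ψ : End (oneGen E G x) ≃* End (oneGen E G x)) :
      ∃ σ s, σ = FirstOrder.Language.Equiv.refl L G ∧ GivenBy ψ σ s := by
    obtain ⟨s, hs⟩ := h ψ
    exact ⟨_, s, rfl, hs⟩
  have hsemi (h : EndSemiperfect E G x) (ψ : End (oneGen E G x) ≃* End (oneGen E G x)) :
      ∃ σ s, True ∧ GivenBy ψ σ s := by
    obtain ⟨σ, s, hs⟩ := h ψ
    exact ⟨σ, s, trivial, hs⟩
  have hinner (h : EndPerfect E G x) (φ : IsoCat (FreeCat E G V) (FreeCat E G V))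
      (hφ : Nonempty (φ.functor.obj (oneGen E G x) ≅ oneGen E G x)) : IsInner φ := by
    obtain ⟨_, s, rfl, hs⟩ := exists_semiInnerBy hstar (hperfect h) φ hφ
    exact hs.isInner
  have hsemiInner (h : EndSemiperfect E G x) (φ : IsoCat (FreeCat E G V) (FreeCat E G V))
      (hφ : Nonempty (φ.functor.obj (oneGen E G x) ≅ oneGen E G x)) : IsSemiInner φ := by
    obtain ⟨σ, s, -, hs⟩ := exists_semiInnerBy hstar (hsemi h) φ hφ
    exact hs.isSemiInner
  refine ⟨fun h => ⟨hinner h, fun hreg φ => hinner h φ (hreg.nonempty_iso φ x)⟩,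
    fun h => ⟨hsemiInner h, fun hreg φ => hsemiInner h φ (hreg.nonempty_iso φ x)⟩,
    fun H₁ H₂ h₁ h₂ => ?_⟩
  have hcorrect (h : GeometricallyEquivalentUpToSemi V H₁ H₂) : CorrectlyIsomorphic V H₁ H₂ := by
    obtain ⟨σ, s, hs, hmatch⟩ := h.exists_isOver
    exact AlgSet.correctlyIsomorphic_of_matchesClosure hmatch hs
  refine ⟨fun h => ⟨fun hc => ?_, hcorrect⟩,
    fun h => ⟨fun hc => ?_, fun he => hcorrect he.upToSemi⟩⟩
  · obtain ⟨σ, -, hσ⟩ := hc.exists_twist hstar (hsemi h) h₁ h₂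
    exact .of_twist hσ
  · obtain ⟨_, rfl, hσ⟩ := hc.exists_twist hstar (hperfect h) h₁ h₂
    exact hσ
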